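/- **Lemma (Unlinkability).** Let $\lambda$ be the security parameter. Let $\mathsf{TS}=(\mathsf{KeyGen},\mathsf{Sign},\mathsf{Agg},\mathsf{Verify})$ be a threshold signature scheme for $n=n(\lambda)$ clients with threshold $t=n-n_{drop}$, $\mathbb G$ a group of prime order $q=q(\lambda)$, and $H,H_1,H_2$ hash functions with values in $\{0,1\}^\lambda$, $\mathbb G$, $\{0,1\}^\lambda$. Put $F_K(x)=H_2(x,H_1(x)^K)$ for $K\in\mathbb Z_q$. Assume that exponentiation in $\mathbb G$, $H_1$, $H_2$ and $\mathsf{Verify}$ are computable by circuits of polynomial size, that the strings involved have polynomial length, and that $\mathsf{TS}$ is *signer-indistinguishable*: no non-uniform PPT adversary that is given the global verification key $\mathcal{VK}$ and adaptive access to an oracle returning a full signature on $m$ by any chosen set of exactly $t$ signers can, for a message $m^\star$ and two sets $\mathcal C_0,\mathcal C_1$ of exactly $t$ signers of its choice, tell with non-negligible advantage whether a given signature on $m^\star$ was made by $\mathcal C_0$ or by $\mathcal C_1$. One round of FedPoP runs as follows. *Generate:* the clients in an online set $\mathcal O$ train local models on their data; the FL server obtains the sum $M$ of their local models by secure aggregation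 with pairwise masks and self-masks; the partial signatures on $M$ of a set $T\subseteq\mathcal O$ of $t$ clients are aggregated to $\sigma$; the server draws a fresh $K\leftarrow\mathbb Z_q$, gives $(M,K,\sigma)$ to every client in $\mathcal O$, and gives $(M,\mathcal{VK},R)$ with $R=F_K(\mathcal{VK})$ to the service provider. *Prove:* a client in $\mathcal O$ sends $H(M)$; if it equals the hash value of the provider's model, the provider draws an invertible $\rho\in\mathbb Z_q$ and sends $\alpha=H_1(\mathcal{VK})^\rho$, the client answers $(\sigma,\beta)$ with $\beta=\alpha^K$, and the provider outputs $1$ iff $\sigma$ verifies on $M$ under $\mathcal{VK}$ and $H_2(\mathcal{VK},\beta^{1/\rho})=R$; otherwise it outputs $0$. The provider's view of the round consists of its inputs $(M,\mathcal{VK},R)$, its coin $\rho$, all messages exchanged in Prove, and its output. Consider two rounds $l=0,1$ with fixed data, online sets $\mathcal O_0,\mathcal O_1$ and training parameters (those of round $1$ may depend on the global model of round $0$), where the threshold keys are either generated anew in each round or generated once and used in both. For each $\lambda$ let $a\in\mathcal O_0\cap\mathcal O_1$ be a client, let $b_0\in\mathcal O_0$, $b_1\in\mathcal O_1$ be distinct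 clients, and let $S_l,T_l\subseteq\mathcal O_l$ be any sets of $t$ clients. All clients and the FL server are honest, and the service provider is honest-but-curious. Then the joint view of the service provider over both rounds when client $a$ proves in both rounds and the models are signed by $S_0,S_1$ is computationally indistinguishable, against non-uniform PPT distinguishers, from its joint view when client $b_0$ proves in round $0$, client $b_1$ proves in round $1$, and the models are signed by $T_0,T_1$. -/

import Mathlib

noncomputable section

namespace FedPoP

/-! ### Non-uniform probabilistic polynomial time -/

/-- Bit strings whose positions are indexed by `ι`. -/
abbrev Bits (ι : Type) : Type := ι → Bool

/-- A Boolean circuit with inputs indexed by `ι` and outputs indexed by `κ`.  Each gate is a NAND of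
two wires; the wire `Sum.inl i` is the `i`-th input, the wire `Sum.inr j` is the value of the `j`-th
gate.  A wire that points to a gate not evaluated yet carries the constant `false`, so a circuit is
always acyclic and the constants are available. -/
structure Circuit (ι κ : Type) where
  gates : List ((ι ⊕ ℕ) × (ι ⊕ ℕ))
  out : κ → ι ⊕ ℕ

namespace Circuit

variable {ι κ : Type}

/-- The value of a wire, given the inputs and the values of the gates evaluated so far. -/
def wire (x : Bits ι) (vals : List Bool) : ι ⊕ ℕ → Bool
  | Sum.inl i => x i
  | Sum.inr j => vals.getD j false

/-- The values of all gates, evaluated in order. -/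
def run (C : Circuit ι κ) (x : Bits ι) : List Bool :=
  C.gates.foldl (fun vals g => vals ++ [!(wire x vals g.1 && wire x vals g.2)]) []

def eval (C : Circuit ι κ) (x : Bits ι) : Bits κ :=
  fun o => wire x (C.run x) (C.out o)

/-- The size of a circuit is its number of gates. -/
def size (C : Circuit ι κ) : ℕ := C.gates.length

end Circuit

def PolyBounded (f : ℕ → ℕ) : Prop :=
  ∃ p : Polynomial ℕ, ∀ k, f k ≤ p.eval k

/-- `f` is eventually smaller than the inverse of every positive polynomial. -/
def Negligible (f : ℕ → ℝ) : Prop :=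
  ∀ p : Polynomial ℝ, (∀ x : ℕ, 0 < p.eval (x : ℝ)) →
    ∃ c : ℕ, 0 < c ∧ ∀ x : ℕ, c < x → f x < 1 / p.eval (x : ℝ)

/-- A distinguisher for bit strings indexed by `ι`: a circuit that also reads uniform coins and
outputs one bit. -/
structure Distinguisher (ι : Type) where
  coins : ℕ
  circuit : Circuit (Fin coins ⊕ ι) Unit

/-- The output of a distinguisher on a sample of the distribution `X`. -/
def Distinguisher.output {ι : Type} (D : Distinguisher ι) (X : PMF (Bits ι)) : PMF Bool := do
  let r ← PMF.uniformOfFintype (Bits (Fin D.coins))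
  let x ← X
  return D.circuit.eval (Sum.elim r x) ()

/-- Computational indistinguishability of two ensembles against non-uniform probabilistic
polynomial-time distinguishers, i.e. polynomial-size families of probabilistic circuits. -/
def CompIndist {ι : ℕ → Type} (X Y : ∀ k, PMF (Bits (ι k))) : Prop :=
  ∀ D : ∀ k, Distinguisher (ι k),
    PolyBounded (fun k => (D k).coins + (D k).circuit.size) →
    Negligible fun k =>
      |(((D k).output (X k)) true).toReal - (((D k).output (Y k)) true).toReal|

/-! ### Threshold signatures -/

/-- Independent samples of a finite family of distributions. -/
def sampleAll {α : Type} : {n : ℕ} → (Fin n → PMF α) → PMF (Fin n → α)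
  | 0, _ => PMF.pure Fin.elim0
  | _ + 1, f => do
      let a ← f 0
      let as ← sampleAll (fun i => f i.succ)
      return Fin.cons a as

/-- The four algorithms of a threshold signature scheme, for each security parameter `k`.
The public parameters are a function of `k`.  `agg` receives the partial signatures of a set of
signers as a partial function of the signer. -/
structure ThresholdScheme where
  vkLen : ℕ → ℕ
  signerVkLen : ℕ → ℕ
  skLen : ℕ → ℕ
  msgLen : ℕ → ℕ
  partialLen : ℕ → ℕ
  sigLen : ℕ → ℕ
  keyGen : ∀ k n : ℕ, (t : ℕ) →
    PMF (Bits (Fin (vkLen k)) × (Fin n → Bits (Fin (signerVkLen k)) × Bits (Fin (skLen k))))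
  sign : ∀ k, Bits (Fin (msgLen k)) → Bits (Fin (skLen k)) → PMF (Bits (Fin (partialLen k)))
  agg : ∀ k n, (Fin n → Option (Bits (Fin (partialLen k)))) → Bits (Fin (vkLen k)) →
    PMF (Bits (Fin (sigLen k)))
  verify : ∀ k, Bits (Fin (sigLen k)) → Bits (Fin (msgLen k)) → Bits (Fin (vkLen k)) → Bool

namespace ThresholdScheme

variable (TS : ThresholdScheme)

abbrev VK (k : ℕ) : Type := Bits (Fin (TS.vkLen k))
abbrev Msg (k : ℕ) : Type := Bits (Fin (TS.msgLen k))
abbrev Sig (k : ℕ) : Type := Bits (Fin (TS.sigLen k))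

/-- The output of key generation: the global verification key, and for every signer a verification
key and a signing key. -/
abbrev Keys (k n : ℕ) : Type :=
  TS.VK k × (Fin n → Bits (Fin (TS.signerVkLen k)) × Bits (Fin (TS.skLen k)))

/-- The full signature on `m` made by the set `T` of signers: every signer in `T` makes a partial
signature, and these are aggregated. -/
def fullSign {k n : ℕ} (keys : TS.Keys k n) (T : Finset (Fin n)) (m : TS.Msg k) :
    PMF (TS.Sig k) := do
  let s ← sampleAll fun i =>
    if i ∈ T then (TS.sign k m (keys.2 i).2).map some else PMF.pure none
  TS.agg k n s keys.1

/-- What a circuit of the adversary may read: its coins, the global verification key, and the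
signatures received so far (bits of signatures not received yet are `false`). -/
abbrev AdvIn (k coins : ℕ) : Type :=
  Fin coins ⊕ Fin (TS.vkLen k) ⊕ (ℕ × Fin (TS.sigLen k))

/-- An adversary against signer indistinguishability with `n` signers, for one value of the security
parameter: it makes `pre` adaptive signing queries, submits a challenge, makes `post` further
adaptive signing queries and outputs a guess. -/
structure SignerAdversary (k n : ℕ) where
  coins : ℕ
  pre : ℕ
  post : ℕ
  /-- The `i`-th signing query: a message and a set of signers. -/
  query : ℕ → Circuit (TS.AdvIn k coins) (Fin (TS.msgLen k) ⊕ Fin n)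
  /-- The challenge: a message and two sets of signers. -/
  challenge : Circuit (TS.AdvIn k coins) (Fin (TS.msgLen k) ⊕ (Fin n ⊕ Fin n))
  guess : Circuit (TS.AdvIn k coins) Unit

namespace SignerAdversary

variable {TS} {k n : ℕ} (A : TS.SignerAdversary k n)

def size : ℕ :=
  A.coins + A.pre + A.post + (∑ i ∈ Finset.range (A.pre + A.post), (A.query i).size) +
    A.challenge.size + A.guess.size

def input (r : Bits (Fin A.coins)) (vk : TS.VK k) (resp : List (TS.Sig k)) :
    Bits (TS.AdvIn k A.coins) :=
  Sum.elim r (Sum.elim vk fun p => (resp.getD p.1 fun _ => false) p.2)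

end SignerAdversary

/-- The set of signers that is described by its indicator bits. -/
def toSet {n : ℕ} (b : Bits (Fin n)) : Finset (Fin n) :=
  Finset.univ.filter fun i => b i = true

/-- The signing oracle answers for authorized sets, which are the sets of exactly `t` signers;
for any other set the answer is the zero string. -/
def oracle {k n : ℕ} (t : ℕ) (keys : TS.Keys k n) (m : TS.Msg k) (T : Finset (Fin n)) :
    PMF (TS.Sig k) :=
  if T.card = t then TS.fullSign keys T m else PMF.pure fun _ => false

/-- The adversary makes its signing queries number `start`, …, `start + count - 1`; the list of
signatures received is extended by the answers. -/
def runQueries {k n : ℕ} (t : ℕ) (keys : TS.Keys k n) (A : TS.SignerAdversary k n)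
    (r : Bits (Fin A.coins)) (start : ℕ) : ℕ → List (TS.Sig k) → PMF (List (TS.Sig k))
  | 0, resp => PMF.pure resp
  | count + 1, resp => do
      let resp' ← runQueries t keys A r start count resp
      let y := (A.query (start + count)).eval (A.input r keys.1 resp')
      let s ← TS.oracle t keys (fun j => y (Sum.inl j)) (toSet fun i => y (Sum.inr i))
      return resp' ++ [s]

/-- The signer-indistinguishability game with hidden bit `b`.  The challenge message is signed by
the first set if `b = false` and by the second if `b = true`; a challenge in which one of the sets
is not authorized is answered by the zero string. -/
def signerGame {k n : ℕ} (t : ℕ) (A : TS.SignerAdversary k n) (b : Bool) : PMF Bool := do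
  let keys ← TS.keyGen k n t
  let r ← PMF.uniformOfFintype (Bits (Fin A.coins))
  let resp ← TS.runQueries t keys A r 0 A.pre []
  let y := A.challenge.eval (A.input r keys.1 resp)
  let m : TS.Msg k := fun j => y (Sum.inl j)
  let C0 : Finset (Fin n) := toSet fun i => y (Sum.inr (Sum.inl i))
  let C1 : Finset (Fin n) := toSet fun i => y (Sum.inr (Sum.inr i))
  let s ← if C0.card = t ∧ C1.card = t then TS.fullSign keys (if b then C1 else C0) m
    else PMF.pure fun _ => false
  let resp' ← TS.runQueries t keys A r A.pre A.post (resp ++ [s])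
  return A.guess.eval (A.input r keys.1 resp') ()

/-- No non-uniform probabilistic polynomial-time adversary can tell which of two authorized sets of
its choice made a signature on a message of its choice. -/
def SignerIndistinguishable (n t : ℕ → ℕ) : Prop :=
  ∀ A : ∀ k, TS.SignerAdversary k (n k), PolyBounded (fun k => (A k).size) →
    Negligible fun k =>
      |(TS.signerGame (t k) (A k) false true).toReal -
        (TS.signerGame (t k) (A k) true true).toReal|

end ThresholdScheme

/-! ### The oblivious pseudorandom function -/

/-- A family of groups of prime order `q k`, with generators and binary encodings. -/
structure GroupFamily where
  G : ℕ → Type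
  [group : ∀ k, CommGroup (G k)]
  [fintype : ∀ k, Fintype (G k)]
  q : ℕ → ℕ
  [prime : ∀ k, Fact (q k).Prime]
  card_eq : ∀ k, Fintype.card (G k) = q k
  gen : ∀ k, G k
  gen_spec : ∀ k x, x ∈ Subgroup.zpowers (gen k)
  eltLen : ℕ → ℕ
  expLen : ℕ → ℕ
  encElt : ∀ k, G k ↪ Bits (Fin (eltLen k))
  encExp : ∀ k, ZMod (q k) ↪ Bits (Fin (expLen k))

attribute [instance] GroupFamily.group GroupFamily.fintype GroupFamily.prime

/-- Exponentiation with exponents in `ℤ/q`, where `q` is the order of the group. -/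
def GroupFamily.pow (𝔾 : GroupFamily) {k : ℕ} (g : 𝔾.G k) (e : ZMod (𝔾.q k)) : 𝔾.G k := g ^ e.val

/-- All the parameters of a FedPoP instance: the number of clients, the maximal number of dropouts,
the threshold signature scheme, the group, the hash functions `H`, `H₁`, `H₂`, and the learning task.
A model is a vector of length `dim k` over `ℤ/modulus k`; `encModel` is its binary encoding.  Local
training may be randomized.  `mask` turns a Diffie–Hellman key into a pairwise mask. -/
structure Instance where
  n : ℕ → ℕ
  nDrop : ℕ → ℕ
  TS : ThresholdScheme
  𝔾 : GroupFamily
  H : ∀ k, List Bool → Bits (Fin k)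
  H₁ : ∀ k, List Bool → 𝔾.G k
  H₂ : ∀ k, List Bool → Bits (Fin k)
  dim : ℕ → ℕ
  modulus : ℕ → ℕ
  [modulus_ne : ∀ k, NeZero (modulus k)]
  encModel : ∀ k, (Fin (dim k) → ZMod (modulus k)) ↪ Bits (Fin (TS.msgLen k))
  Params : Type
  Data : Type
  train : ∀ k, Params → Data → PMF (Fin (dim k) → ZMod (modulus k))
  mask : ∀ k, 𝔾.G k → (Fin (dim k) → ZMod (modulus k))

attribute [instance] Instance.modulus_ne

namespace Instance

variable (P : Instance)

/-- The threshold `t = n - n_drop`. -/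
def t (k : ℕ) : ℕ := P.n k - P.nDrop k

abbrev Model (k : ℕ) : Type := Fin (P.dim k) → ZMod (P.modulus k)

abbrev Client (k : ℕ) : Type := Fin (P.n k)

/-- The argument `(x, g)` of `H₂`, as a bit string. -/
def pairStr {k : ℕ} (x : P.TS.VK k) (g : P.𝔾.G k) : List Bool :=
  List.ofFn x ++ List.ofFn (P.𝔾.encElt k g)

/-- The function `F_K(x) = H₂(x, H₁(x)^K)`. -/
def prf {k : ℕ} (K : ZMod (P.𝔾.q k)) (x : P.TS.VK k) : Bits (Fin k) :=
  P.H₂ k (P.pairStr x (P.𝔾.pow (P.H₁ k (List.ofFn x)) K))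

/-- The deterministic computations of the proving phase are feasible: exponentiation, the hash
functions `H₁`, `H₂` (on inputs of any length) and signature verification have circuits of
polynomial size, and all the strings that occur have polynomial length. -/
structure Efficient : Prop where
  vkLen : PolyBounded P.TS.vkLen
  msgLen : PolyBounded P.TS.msgLen
  sigLen : PolyBounded P.TS.sigLen
  eltLen : PolyBounded P.𝔾.eltLen
  expLen : PolyBounded P.𝔾.expLen
  pow : ∃ C : ∀ k, Circuit (Fin (P.𝔾.eltLen k) ⊕ Fin (P.𝔾.expLen k)) (Fin (P.𝔾.eltLen k)),
    PolyBounded (fun k => (C k).size) ∧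
    ∀ k g e, (C k).eval (Sum.elim (P.𝔾.encElt k g) (P.𝔾.encExp k e)) =
      P.𝔾.encElt k (P.𝔾.pow g e)
  hash₁ : ∃ p : Polynomial ℕ, ∀ k L, ∃ C : Circuit (Fin L) (Fin (P.𝔾.eltLen k)),
    C.size ≤ p.eval (k + L) ∧ ∀ x, C.eval x = P.𝔾.encElt k (P.H₁ k (List.ofFn x))
  hash₂ : ∃ p : Polynomial ℕ, ∀ k L, ∃ C : Circuit (Fin L) (Fin k),
    C.size ≤ p.eval (k + L) ∧ ∀ x, C.eval x = P.H₂ k (List.ofFn x)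
  verify : ∃ C : ∀ k,
      Circuit (Fin (P.TS.sigLen k) ⊕ (Fin (P.TS.msgLen k) ⊕ Fin (P.TS.vkLen k))) Unit,
    PolyBounded (fun k => (C k).size) ∧
    ∀ k s m vk, (C k).eval (Sum.elim s (Sum.elim m vk)) () = P.TS.verify k s m vk

/-! ### Secure aggregation -/

/-- The signed pairwise mask that client `i` adds for its neighbour `j`; it is derived from the
Diffie–Hellman key of the two clients. -/
def pairMask {k : ℕ} (x : P.Client k → ZMod (P.𝔾.q k)) (i j : P.Client k) : P.Model k :=
  if i < j then P.mask k (P.𝔾.pow (P.𝔾.gen k) (x i * x j))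
  else -P.mask k (P.𝔾.pow (P.𝔾.gen k) (x i * x j))

open Classical in
/-- The masked update of client `i`, with local model `m i`, self-mask `b i` and private key `x i`;
`N` is the neighbourhood graph of the clients. -/
def protect {k : ℕ} (N : SimpleGraph (P.Client k)) (x : P.Client k → ZMod (P.𝔾.q k))
    (b m : P.Client k → P.Model k) (i : P.Client k) : P.Model k :=
  m i + b i + ∑ j with N.Adj i j, P.pairMask x i j

open Classical in
/-- The server adds the masked updates `c` of the online clients, having removed from them the
self-masks and the pairwise masks shared with dropped clients. -/
def aggregate {k : ℕ} (N : SimpleGraph (P.Client k)) (O : Finset (P.Client k))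
    (x : P.Client k → ZMod (P.𝔾.q k)) (b c : P.Client k → P.Model k) : P.Model k :=
  ∑ i ∈ O, (c i - b i - ∑ j with N.Adj i j ∧ j ∉ O, P.pairMask x i j)

/-- Training on the data `D` with secure aggregation over the online clients `O`. -/
def globalModel {k : ℕ} (N : SimpleGraph (P.Client k)) (O : Finset (P.Client k)) (pp : P.Params)
    (D : P.Client k → P.Data) : PMF (P.Model k) := do
  let x ← PMF.uniformOfFintype (P.Client k → ZMod (P.𝔾.q k))
  let b ← PMF.uniformOfFintype (P.Client k → P.Model k)
  let m ← sampleAll fun i => P.train k pp (D i)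
  return P.aggregate N O x b (P.protect N x b m)

/-! ### The protocol -/

/-- What the service provider obtains from the server after the generation phase. -/
structure ProviderTuple (k : ℕ) where
  model : P.Model k
  vk : P.TS.VK k
  R : Bits (Fin k)

/-- What a participating client stores after the generation phase. -/
structure ClientTuple (k : ℕ) where
  model : P.Model k
  K : ZMod (P.𝔾.q k)
  sig : P.TS.Sig k

/-- The result of a generation phase with online clients `O`. -/
structure GenerateOutput (k : ℕ) (O : Finset (P.Client k)) where
  provider : P.ProviderTuple k
  client : {i // i ∈ O} → P.ClientTuple k

/-- The generation phase: the global model is trained and aggregated, signed by the partial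
signatures of the clients in `T`, and the server draws a fresh key `K`. -/
def generate {k : ℕ} (keys : P.TS.Keys k (P.n k)) (N : SimpleGraph (P.Client k))
    (O T : Finset (P.Client k)) (pp : P.Params) (D : P.Client k → P.Data) :
    PMF (P.GenerateOutput k O) := do
  let M ← P.globalModel N O pp D
  let s ← P.TS.fullSign keys T (P.encModel k M)
  let K ← PMF.uniformOfFintype (ZMod (P.𝔾.q k))
  return { provider := ⟨M, keys.1, P.prf K keys.1⟩, client := fun _ => ⟨M, K, s⟩ }

/-- The view of the service provider in one round: its inputs, its blinding exponent `ρ`, the hash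
value it receives, the remaining messages `(α, σ, β)` (absent if the hash values differ), and its
output. -/
structure RoundView (k : ℕ) where
  input : P.ProviderTuple k
  ρ : ZMod (P.𝔾.q k)
  hash : Bits (Fin k)
  messages : Option (P.𝔾.G k × P.TS.Sig k × P.𝔾.G k)
  output : Bool

/-- The proving phase between a client holding `c` and the service provider holding `s`. -/
def prove {k : ℕ} (c : P.ClientTuple k) (s : P.ProviderTuple k) : PMF (P.RoundView k) := do
  let u ← PMF.uniformOfFintype (ZMod (P.𝔾.q k))ˣ
  let ρ : ZMod (P.𝔾.q k) := u
  let h := P.H k (List.ofFn (P.encModel k c.model))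
  if h = P.H k (List.ofFn (P.encModel k s.model)) then
    let α := P.𝔾.pow (P.H₁ k (List.ofFn s.vk)) ρ
    let β := P.𝔾.pow α c.K
    let accept := P.TS.verify k c.sig (P.encModel k s.model) s.vk &&
      decide (P.H₂ k (P.pairStr s.vk (P.𝔾.pow β ρ⁻¹)) = s.R)
    return ⟨s, ρ, h, some (α, c.sig, β), accept⟩
  else
    return ⟨s, ρ, h, none, false⟩

/-- Whether the key generation of the threshold signature scheme is run anew in each round, or once
for both rounds. -/
inductive KeySchedule
  | perRound
  | shared

/-- The circumstances of two rounds that do not depend on who proves: the data of the clients, the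
online clients and the neighbourhood graph of each round, and the initial model parameters of the
first round and (as a function of the first global model) of the second. -/
structure TwoRounds (k : ℕ) where
  data : Fin 2 → P.Client k → P.Data
  online : Fin 2 → Finset (P.Client k)
  graph : Fin 2 → SimpleGraph (P.Client k)
  params₀ : P.Params
  params₁ : P.Model k → P.Params

/-- The joint view of the service provider in two rounds in which the global model of round `l` is
signed by the clients in `T l` and the client `prover l` proves. -/
def jointView {k : ℕ} (sched : KeySchedule) (E : P.TwoRounds k)
    (T : Fin 2 → Finset (P.Client k)) (prover : ∀ l, {i // i ∈ E.online l}) :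
    PMF (P.RoundView k × P.RoundView k) := do
  let keys₀ ← P.TS.keyGen k (P.n k) (P.t k)
  let keys₁ ← match sched with
    | .perRound => P.TS.keyGen k (P.n k) (P.t k)
    | .shared => PMF.pure keys₀
  let g₀ ← P.generate keys₀ (E.graph 0) (E.online 0) (T 0) E.params₀ (E.data 0)
  let v₀ ← P.prove (g₀.client (prover 0)) g₀.provider
  let g₁ ← P.generate keys₁ (E.graph 1) (E.online 1) (T 1) (E.params₁ g₀.provider.model)
    (E.data 1)
  let v₁ ← P.prove (g₁.client (prover 1)) g₁.provider
  return (v₀, v₁)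

/-! ### Binary encoding of views -/

abbrev MessagesIdx (k : ℕ) : Type :=
  Fin (P.𝔾.eltLen k) ⊕ (Fin (P.TS.sigLen k) ⊕ Fin (P.𝔾.eltLen k))

abbrev RoundIdx (k : ℕ) : Type :=
  Fin (P.TS.msgLen k) ⊕ (Fin (P.TS.vkLen k) ⊕ (Fin k ⊕ (Fin (P.𝔾.expLen k) ⊕ (Fin k ⊕
    ((Unit ⊕ P.MessagesIdx k) ⊕ Unit)))))

/-- A bit that tells whether the messages are present, then the messages. -/
def encMessages {k : ℕ} :
    Option (P.𝔾.G k × P.TS.Sig k × P.𝔾.G k) → Bits (Unit ⊕ P.MessagesIdx k)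
  | none => fun _ => false
  | some (α, s, β) => Sum.elim (fun _ => true)
      (Sum.elim (P.𝔾.encElt k α) (Sum.elim s (P.𝔾.encElt k β)))

def encRound {k : ℕ} (v : P.RoundView k) : Bits (P.RoundIdx k) :=
  Sum.elim (P.encModel k v.input.model) (Sum.elim v.input.vk (Sum.elim v.input.R
    (Sum.elim (P.𝔾.encExp k v.ρ) (Sum.elim v.hash
      (Sum.elim (P.encMessages v.messages) (fun _ => v.output))))))

def encViews {k : ℕ} (v : P.RoundView k × P.RoundView k) : Bits (P.RoundIdx k ⊕ P.RoundIdx k) :=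
  Sum.elim (P.encRound v.1) (P.encRound v.2)

end Instance

end FedPoP

end

/-! Two features separate the joint views: who proves and who signs. The first leaves no trace at
all. Every online client stores the same triple `(M, K, σ)`, and an honest proof always passes the
hash and the OPRF check, so the view of a round is a function `roundView` of the model, `K`, `ρ`,
the verification key and the signature (`prove_eq`, `generate_prove`).

The second is hidden by signer indistinguishability. Models, `K` and `ρ` do not depend on keys or
signatures, so they can be sampled beforehand (`jointView_eq`) and, together with the coins of the
distinguisher, fixed as non-uniform advice. What remains is a polynomial-size circuit reading the
verification keys and signatures (`Efficient.distinguisher`). The signers are replaced one round at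
a time (`exists_negligible_signers`). The replaced signature is the challenge. With a shared key the
other signature comes from the signing oracle; with fresh keys it is independent of the challenge
and becomes advice as well.

The advice ranges over a finite set, so for each `k` a worst value exists. Hard-wiring it gives a
single adversary whose advantage bounds all the others (`SignerIndistinguishable.uniform`), and
averaging returns to the random choices. -/

noncomputable section

namespace FedPoP

/-! ### Closure properties of circuits -/

namespace Circuit

variable {ι κ ι' μ : Type}

/-- `f` has a circuit with at most `s` gates. -/
def HasCircuit (s : ℕ) (f : Bits ι → Bits κ) : Prop :=
  ∃ C : Circuit ι κ, C.size ≤ s ∧ ∀ x, C.eval x = f x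

/-- The evaluation of further gates, given the values of the gates evaluated so far. -/
def runFrom (x : Bits ι) (vals : List Bool) (gates : List ((ι ⊕ ℕ) × (ι ⊕ ℕ))) : List Bool :=
  gates.foldl (fun vals g => vals ++ [!(wire x vals g.1 && wire x vals g.2)]) vals

theorem run_eq_runFrom (C : Circuit ι κ) (x : Bits ι) : C.run x = runFrom x [] C.gates := rfl

theorem length_runFrom (x : Bits ι) (gates : List ((ι ⊕ ℕ) × (ι ⊕ ℕ))) (vals : List Bool) :
    (runFrom x vals gates).length = vals.length + gates.length := by
  induction gates generalizing vals with
  | nil => simp [runFrom]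
  | cons g gs ih =>
    have := ih (vals ++ [!(wire x vals g.1 && wire x vals g.2)])
    simp only [runFrom, List.foldl_cons, List.length_cons] at this ⊢
    rw [this]
    simp
    omega

theorem length_run (C : Circuit ι κ) (x : Bits ι) : (C.run x).length = C.size := by
  simp [run_eq_runFrom, length_runFrom, size]

/-- The wire of `C.out b`, where a dangling wire is redirected to position `N`. -/
def outAt (C : Circuit ι κ) (N : ℕ) (b : κ) : ι ⊕ ℕ :=
  match C.out b with
  | Sum.inl a => Sum.inl a
  -- A dangling output of `C` would read a gate of the circuit appended later. Moved to a position
  -- past all gates, it still reads `false`.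
  | Sum.inr j => if j < C.size then Sum.inr j else Sum.inr N

/-- The translation of the wires of a circuit that is run after `C`. -/
def shiftWire (C : Circuit ι κ) (w : ι' → ι ⊕ κ) (N : ℕ) : ι' ⊕ ℕ → ι ⊕ ℕ
  | Sum.inl i => Sum.elim Sum.inl (C.outAt N) (w i)
  | Sum.inr j => Sum.inr (C.size + j)

/-- Run `C`, and then `D` on inputs chosen by `w` among the inputs and outputs of `C`. -/
def seq (C : Circuit ι κ) (D : Circuit ι' μ) (w : ι' → ι ⊕ κ) : Circuit ι (κ ⊕ μ) where
  gates := C.gates ++ D.gates.map fun g =>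
    (C.shiftWire w (C.size + D.size) g.1, C.shiftWire w (C.size + D.size) g.2)
  out := Sum.elim (C.outAt (C.size + D.size)) fun o => C.shiftWire w (C.size + D.size) (D.out o)

theorem size_seq (C : Circuit ι κ) (D : Circuit ι' μ) (w : ι' → ι ⊕ κ) :
    (C.seq D w).size = C.size + D.size := by
  simp [seq, size]

theorem wire_outAt (C : Circuit ι κ) (x : Bits ι) {N : ℕ} {ds : List Bool}
    (h : C.size + ds.length ≤ N) (b : κ) :
    wire x (C.run x ++ ds) (C.outAt N b) = C.eval x b := by
  have hl := C.length_run x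
  unfold outAt eval
  rcases C.out b with i | j
  · rfl
  · dsimp only
    split_ifs with hj
    · simp only [wire]
      rw [List.getD_append _ _ _ _ (by omega)]
    · simp only [wire]
      rw [List.getD_eq_default _ _ (by simp; omega), List.getD_eq_default _ _ (by omega)]

theorem wire_shiftWire (C : Circuit ι κ) (w : ι' → ι ⊕ κ) (x : Bits ι) {N : ℕ} {ds : List Bool}
    (h : C.size + ds.length ≤ N) (v : ι' ⊕ ℕ) :
    wire x (C.run x ++ ds) (C.shiftWire w N v) =
      wire (fun i => Sum.elim x (C.eval x) (w i)) ds v := by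
  rcases v with i | j
  · simp only [shiftWire, wire]
    rcases w i with a | b
    · rfl
    · exact C.wire_outAt x h b
  · simp only [shiftWire, wire]
    rw [List.getD_append_right _ _ _ _ (by rw [C.length_run]; omega), C.length_run]
    simp

/-- The invariant of sequential composition: the list of values is always that of `C` followed by
that of the second circuit, so a shift by `C.size` aligns the gates. The bound on `N` keeps
redirected wires beyond the end of the list throughout. -/
theorem runFrom_shiftWire (C : Circuit ι κ) (w : ι' → ι ⊕ κ) (x : Bits ι) {N : ℕ}
    (gates : List ((ι' ⊕ ℕ) × (ι' ⊕ ℕ))) (ds : List Bool)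
    (h : C.size + ds.length + gates.length ≤ N) :
    runFrom x (C.run x ++ ds) (gates.map fun g => (C.shiftWire w N g.1, C.shiftWire w N g.2)) =
      C.run x ++ runFrom (fun i => Sum.elim x (C.eval x) (w i)) ds gates := by
  induction gates generalizing ds with
  | nil => rfl
  | cons g gs ih =>
    simp only [List.length_cons] at h
    simp only [runFrom, List.map_cons, List.foldl_cons] at ih ⊢
    rw [C.wire_shiftWire w x (by omega), C.wire_shiftWire w x (by omega), List.append_assoc]
    exact ih _ (by simp; omega)

theorem run_seq (C : Circuit ι κ) (D : Circuit ι' μ) (w : ι' → ι ⊕ κ) (x : Bits ι) :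
    (C.seq D w).run x = C.run x ++ D.run fun i => Sum.elim x (C.eval x) (w i) := by
  have h := C.runFrom_shiftWire w x (N := C.size + D.size) D.gates [] (by simp [size])
  rw [List.append_nil] at h
  rw [run_eq_runFrom D, ← h]
  simp only [run, runFrom, seq, List.foldl_append]

theorem eval_seq (C : Circuit ι κ) (D : Circuit ι' μ) (w : ι' → ι ⊕ κ) (x : Bits ι) :
    (C.seq D w).eval x =
      Sum.elim (C.eval x) (D.eval fun i => Sum.elim x (C.eval x) (w i)) := by
  have hN : C.size + (D.run fun i => Sum.elim x (C.eval x) (w i)).length ≤ C.size + D.size := by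
    rw [D.length_run]
  funext o
  conv_lhs => rw [eval, run_seq]
  rcases o with b | o
  · exact C.wire_outAt x hN b
  · exact C.wire_shiftWire w x hN (D.out o)

namespace HasCircuit

variable {s s' : ℕ}

theorem mono {f : Bits ι → Bits κ} (h : HasCircuit s f) (hs : s ≤ s') : HasCircuit s' f :=
  let ⟨C, h₁, h₂⟩ := h
  ⟨C, h₁.trans hs, h₂⟩

/-- Selecting input bits and constants takes one gate, for the constant `true`. -/
theorem select (w : κ → ι ⊕ Bool) :
    HasCircuit 1 fun (x : Bits ι) o => Sum.elim x id (w o) := by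
  -- The only gate reads itself before it has a value, hence computes NAND of `false` and `false`,
  -- which is `true`. Wire `1` lies past the end and supplies `false`. Outputs are not counted in
  -- the size, so advice of any length costs one gate.
  refine ⟨⟨[(Sum.inr 0, Sum.inr 0)],
    fun o => Sum.elim Sum.inl (fun b => Sum.inr (if b then 0 else 1)) (w o)⟩, le_rfl, fun x => ?_⟩
  funext o
  simp only [eval, run]
  rcases w o with i | b
  · rfl
  · cases b <;> rfl

theorem proj (w : κ → ι) : HasCircuit 1 fun (x : Bits ι) o => x (w o) :=
  select fun o => Sum.inl (w o)

theorem const (c : Bits κ) : HasCircuit 1 fun _ : Bits ι => c :=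
  select fun o => Sum.inr (c o)

theorem reindex {f : Bits ι → Bits κ} (h : HasCircuit s f) (v : μ → κ) :
    HasCircuit s fun x o => f x (v o) := by
  obtain ⟨C, h₁, h₂⟩ := h
  refine ⟨⟨C.gates, fun o => C.out (v o)⟩, h₁, fun x => ?_⟩
  exact funext fun o => congrFun (h₂ x) (v o)

theorem sumElim {f : Bits ι → Bits κ} {g : Bits ι → Bits μ} (hf : HasCircuit s f)
    (hg : HasCircuit s' g) : HasCircuit (s + s') fun x => Sum.elim (f x) (g x) := by
  obtain ⟨C, hC, hC'⟩ := hf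
  obtain ⟨D, hD, hD'⟩ := hg
  -- With `Sum.inl` the second circuit reads the original inputs, in parallel with `C`; with
  -- `Sum.inr`, as in `comp`, it reads the outputs of `C`.
  refine ⟨C.seq D Sum.inl, ?_, fun x => ?_⟩
  · rw [size_seq]
    exact Nat.add_le_add hC hD
  · rw [eval_seq, hC']
    exact congrArg _ (hD' x)

theorem comp {f : Bits ι → Bits κ} {g : Bits κ → Bits μ} (hg : HasCircuit s' g)
    (hf : HasCircuit s f) : HasCircuit (s + s') fun x => g (f x) := by
  obtain ⟨C, hC, hC'⟩ := hf
  obtain ⟨D, hD, hD'⟩ := hg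
  have h : HasCircuit (s + s') (C.seq D Sum.inr).eval :=
    ⟨_, by rw [size_seq]; exact Nat.add_le_add hC hD, fun _ => rfl⟩
  have h' := h.reindex (Sum.inr : μ → κ ⊕ μ)
  simp only [eval_seq, Sum.elim_inr, hC', hD'] at h'
  exact h'

end HasCircuit

end Circuit

/-! ### Polynomial bounds and negligible functions -/

theorem polyBounded_const (c : ℕ) : PolyBounded fun _ => c :=
  ⟨Polynomial.C c, fun k => by simp⟩

theorem polyBounded_id : PolyBounded fun k => k :=
  ⟨Polynomial.X, fun k => by simp⟩

theorem PolyBounded.mono {f g : ℕ → ℕ} (hg : PolyBounded g) (h : ∀ k, f k ≤ g k) :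
    PolyBounded f :=
  let ⟨p, hp⟩ := hg
  ⟨p, fun k => (h k).trans (hp k)⟩

theorem PolyBounded.add {f g : ℕ → ℕ} (hf : PolyBounded f) (hg : PolyBounded g) :
    PolyBounded fun k => f k + g k := by
  obtain ⟨p, hp⟩ := hf
  obtain ⟨r, hr⟩ := hg
  exact ⟨p + r, fun k => by simpa using Nat.add_le_add (hp k) (hr k)⟩

/-- Coefficients in `ℕ` are nonnegative, so each monomial is monotone. -/
theorem eval_natPolynomial_mono (p : Polynomial ℕ) {a b : ℕ} (h : a ≤ b) :
    p.eval a ≤ p.eval b := by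
  rw [Polynomial.eval_eq_sum, Polynomial.eval_eq_sum]
  exact Finset.sum_le_sum fun i _ => Nat.mul_le_mul_left _ (Nat.pow_le_pow_left h i)

theorem PolyBounded.eval {f : ℕ → ℕ} (hf : PolyBounded f) (p : Polynomial ℕ) :
    PolyBounded fun k => p.eval (f k) := by
  obtain ⟨r, hr⟩ := hf
  exact ⟨p.comp r, fun k => by
    rw [Polynomial.eval_comp]
    exact eval_natPolynomial_mono p (hr k)⟩

theorem Negligible.mono {f g : ℕ → ℝ} (hg : Negligible g) (h : ∀ k, f k ≤ g k) :
    Negligible f := fun p hp =>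
  let ⟨c, hc, hc'⟩ := hg p hp
  ⟨c, hc, fun x hx => (h x).trans_lt (hc' x hx)⟩

theorem Negligible.add {f g : ℕ → ℝ} (hf : Negligible f) (hg : Negligible g) :
    Negligible fun k => f k + g k := by
  intro p hp
  -- Each summand is tested against `2p`, so that the two halves add up to `1/p`.
  have hp' : ∀ x : ℕ, 0 < (Polynomial.C 2 * p).eval (x : ℝ) := fun x => by
    simpa using hp x
  obtain ⟨c, hc, hc'⟩ := hf _ hp'
  obtain ⟨d, _, hd'⟩ := hg _ hp'
  refine ⟨max c d, lt_max_of_lt_left hc, fun x hx => ?_⟩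
  have h₁ := hc' x ((le_max_left _ _).trans_lt hx)
  have h₂ := hd' x ((le_max_right _ _).trans_lt hx)
  have h₃ : 1 / (Polynomial.C 2 * p).eval (x : ℝ) + 1 / (Polynomial.C 2 * p).eval (x : ℝ) =
      1 / p.eval (x : ℝ) := by
    have := (hp x).ne'
    simp only [Polynomial.eval_mul, Polynomial.eval_C]
    field_simp
    norm_num
  linarith

/-! ### Averaging -/

/-- If the probabilities of an event differ by at most `ε` for every value of a random choice, then
they do so on average. -/
theorem abs_toReal_bind_sub_le {α β : Type} (p : PMF α) (f g : α → PMF β) (b : β) {ε : ℝ}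
    (h : ∀ a, |((f a) b).toReal - ((g a) b).toReal| ≤ ε) :
    |((p.bind f) b).toReal - ((p.bind g) b).toReal| ≤ ε := by
  have hp : HasSum (fun a => (p a).toReal) 1 := by
    have := ENNReal.hasSum_toReal (f := fun a => p a) (by rw [p.tsum_coe]; simp)
    rwa [← ENNReal.tsum_toReal_eq p.apply_ne_top, p.tsum_coe, ENNReal.toReal_one] at this
  have hs (f : α → PMF β) :
      HasSum (fun a => (p a).toReal * ((f a) b).toReal) ((p.bind f) b).toReal := by
    have hne : ∑' a, p a * (f a) b ≠ ⊤ := by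
      rw [← PMF.bind_apply]
      exact PMF.apply_ne_top _ _
    have := ENNReal.hasSum_toReal hne
    rw [← ENNReal.tsum_toReal_eq (ENNReal.ne_top_of_tsum_ne_top hne)] at this
    simpa only [PMF.bind_apply, ENNReal.toReal_mul] using this
  have hsub := (hs f).sub (hs g)
  have hle : ∀ a, |(p a).toReal * ((f a) b).toReal - (p a).toReal * ((g a) b).toReal| ≤
      (p a).toReal * ε := fun a => by
    rw [← mul_sub, abs_mul, abs_of_nonneg ENNReal.toReal_nonneg]
    exact mul_le_mul_of_nonneg_left (h a) ENNReal.toReal_nonneg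
  have hε := hp.mul_right ε
  rw [one_mul] at hε
  rw [abs_le]
  constructor
  · exact hasSum_le (fun a => (abs_le.1 (hle a)).1) hε.neg hsub
  · exact hasSum_le (fun a => (abs_le.1 (hle a)).2) hsub hε

open Circuit

/-- The reduction of the exponent modulo `q` is harmless because `q` is the order of the group. -/
theorem GroupFamily.pow_pow_eq (𝔾 : GroupFamily) {k : ℕ} (g : 𝔾.G k) (e f : ZMod (𝔾.q k)) :
    𝔾.pow (𝔾.pow g e) f = 𝔾.pow g (e * f) := by
  simp only [GroupFamily.pow]
  have h := pow_mod_card g (e.val * f.val)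
  rw [𝔾.card_eq k] at h
  rw [← pow_mul, ZMod.val_mul, h]

namespace Instance

variable (P : Instance)

/-! ### The view of an accepted proof -/

/-- The view of one round as a function of the global model, the key and the blinding exponent, and
of the verification key and the signature. -/
def roundView {k : ℕ} (M : P.Model k) (K ρ : ZMod (P.𝔾.q k)) (vk : P.TS.VK k) (s : P.TS.Sig k) :
    P.RoundView k where
  input := ⟨M, vk, P.prf K vk⟩
  ρ := ρ
  hash := P.H k (List.ofFn (P.encModel k M))
  messages := some (P.𝔾.pow (P.H₁ k (List.ofFn vk)) ρ, s,
    P.𝔾.pow (P.𝔾.pow (P.H₁ k (List.ofFn vk)) ρ) K)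
  output := P.TS.verify k s (P.encModel k M) vk

/-- Both parties hold the same model, so the hash values agree. Since `ρ` is invertible, unblinding
`β` gives `H₁(vk)^K`, so the comparison with `R` succeeds and only signature verification decides
the output. -/
theorem prove_eq {k : ℕ} (M : P.Model k) (K : ZMod (P.𝔾.q k)) (vk : P.TS.VK k)
    (s : P.TS.Sig k) :
    P.prove ⟨M, K, s⟩ ⟨M, vk, P.prf K vk⟩ =
      (PMF.uniformOfFintype (ZMod (P.𝔾.q k))ˣ).bind fun u =>
        PMF.pure (P.roundView M K u vk s) := by
  unfold prove
  refine congrArg (PMF.bind _) (funext fun u => ?_)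
  have h : P.𝔾.pow (P.𝔾.pow (P.𝔾.pow (P.H₁ k (List.ofFn vk)) u) K) (u : ZMod (P.𝔾.q k))⁻¹ =
      P.𝔾.pow (P.H₁ k (List.ofFn vk)) K := by
    rw [P.𝔾.pow_pow_eq, P.𝔾.pow_pow_eq]
    congr 1
    rw [mul_comm K, mul_inv_cancel_left₀ u.ne_zero]
  dsimp only
  rw [if_pos rfl, h]
  have h' : decide (P.H₂ k (P.pairStr vk (P.𝔾.pow (P.H₁ k (List.ofFn vk)) K)) = P.prf K vk) =
      true := decide_eq_true rfl
  rw [h', Bool.and_true]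
  rfl

variable {P}

/-- The view of a round is computed from the verification key and the signature by circuits of
polynomial size. -/
theorem Efficient.roundView (hP : P.Efficient) :
    ∃ B : ℕ → ℕ, PolyBounded B ∧ ∀ (k : ℕ) (M : P.Model k) (K ρ : ZMod (P.𝔾.q k)),
      HasCircuit (B k) fun x : Bits (Fin (P.TS.vkLen k) ⊕ Fin (P.TS.sigLen k)) =>
        P.encRound (P.roundView M K ρ (fun i => x (Sum.inl i)) fun i => x (Sum.inr i)) := by
  obtain ⟨Cp, hCp, hCp'⟩ := hP.pow
  obtain ⟨p₁, h₁⟩ := hP.hash₁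
  obtain ⟨p₂, h₂⟩ := hP.hash₂
  obtain ⟨Cv, hCv, hCv'⟩ := hP.verify
  let B₁ : ℕ → ℕ := fun k => p₁.eval (k + P.TS.vkLen k)
  let B₂ : ℕ → ℕ := fun k => p₂.eval (k + (P.TS.vkLen k + P.𝔾.eltLen k))
  have hB₁ : PolyBounded B₁ := (polyBounded_id.add hP.vkLen).eval p₁
  have hB₂ : PolyBounded B₂ := (polyBounded_id.add (hP.vkLen.add hP.eltLen)).eval p₂
  -- A generous count: `H₁` and exponentiation are recomputed for each of `α`, `β` and `R`, and `30`
  -- covers the selections and constants. The bound must not depend on `M`, `K`, `ρ`, which are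
  -- hard-wired.
  refine ⟨fun k => 30 + (4 * B₁ k + 4 * (Cp k).size + B₂ k + (Cv k).size), ?_,
    fun k M K ρ => ?_⟩
  · refine (polyBounded_const _).add (PolyBounded.add (PolyBounded.add (PolyBounded.add ?_ ?_) hB₂)
      hCv)
    · exact (((hB₁.add hB₁).add hB₁).add hB₁).mono fun k => by omega
    · exact (((hCp.add hCp).add hCp).add hCp).mono fun k => by omega
  let vk (x : Bits (Fin (P.TS.vkLen k) ⊕ Fin (P.TS.sigLen k))) : P.TS.VK k := fun i => x (Sum.inl i)
  let sg (x : Bits (Fin (P.TS.vkLen k) ⊕ Fin (P.TS.sigLen k))) : P.TS.Sig k :=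
    fun i => x (Sum.inr i)
  have cvk : HasCircuit 1 vk := HasCircuit.proj Sum.inl
  have csg : HasCircuit 1 sg := HasCircuit.proj Sum.inr
  have cpow {s : ℕ} {g : Bits (Fin (P.TS.vkLen k) ⊕ Fin (P.TS.sigLen k)) → P.𝔾.G k}
      (e : ZMod (P.𝔾.q k)) (h : HasCircuit s fun x => P.𝔾.encElt k (g x)) :
      HasCircuit (s + 1 + (Cp k).size) fun x => P.𝔾.encElt k (P.𝔾.pow (g x) e) := by
    have := HasCircuit.comp (g := (Cp k).eval) ⟨Cp k, le_rfl, fun _ => rfl⟩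
      (h.sumElim (HasCircuit.const (P.𝔾.encExp k e)))
    simpa only [hCp'] using this
  have ch₁ : HasCircuit (1 + B₁ k) fun x => P.𝔾.encElt k (P.H₁ k (List.ofFn (vk x))) :=
    HasCircuit.comp (g := fun y => P.𝔾.encElt k (P.H₁ k (List.ofFn y))) (h₁ k _) cvk
  have cα := cpow ρ ch₁
  have cβ := cpow K cα
  have cR : HasCircuit (1 + (1 + B₁ k + 1 + (Cp k).size) + B₂ k) fun x => P.prf K (vk x) := by
    have := HasCircuit.comp (g := fun y => P.H₂ k (List.ofFn y)) (h₂ k _)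
      ((cvk.sumElim (cpow K ch₁)).reindex finSumFinEquiv.symm)
    refine (congrArg (HasCircuit _) (funext fun x => ?_)).mp this
    unfold prf pairStr
    rw [List.ofFn_add]
    refine congrArg (P.H₂ k) (congrArg₂ _ (congrArg _ (funext fun i => ?_))
      (congrArg _ (funext fun i => ?_)))
    · exact congrArg (Sum.elim _ _) (finSumFinEquiv_symm_apply_castAdd i)
    · exact congrArg (Sum.elim _ _) (finSumFinEquiv_symm_apply_natAdd i)
  have cout : HasCircuit (1 + (1 + 1) + (Cv k).size)
      fun x (_ : Unit) => P.TS.verify k (sg x) (P.encModel k M) (vk x) := by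
    have := HasCircuit.comp (g := (Cv k).eval) ⟨Cv k, le_rfl, fun _ => rfl⟩
      (csg.sumElim ((HasCircuit.const (P.encModel k M)).sumElim cvk))
    refine (congrArg (HasCircuit _) (funext fun x => funext fun _ => ?_)).mp this
    exact hCv' k _ _ _
  -- The value of `H` depends on `M` alone, so it enters as a constant and needs no circuit for `H`.
  have c := (HasCircuit.const (P.encModel k M)).sumElim (cvk.sumElim (cR.sumElim
    ((HasCircuit.const (P.𝔾.encExp k ρ)).sumElim
      ((HasCircuit.const (P.H k (List.ofFn (P.encModel k M)))).sumElim
        (((HasCircuit.const fun _ : Unit => true).sumElim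
          (cα.sumElim (csg.sumElim cβ))).sumElim cout)))))
  exact c.mono (by dsimp only; omega)

/-- A distinguisher of the views of two rounds is computed from the two verification keys and the
two signatures by circuits of polynomial size. -/
theorem Efficient.distinguisher (hP : P.Efficient)
    (D : ∀ k, Distinguisher (P.RoundIdx k ⊕ P.RoundIdx k))
    (hD : PolyBounded fun k => (D k).coins + (D k).circuit.size) :
    ∃ B : ℕ → ℕ, PolyBounded B ∧ ∀ (k : ℕ) (M₀ M₁ : P.Model k) (K₀ ρ₀ K₁ ρ₁ : ZMod (P.𝔾.q k))
      (r : Bits (Fin (D k).coins)) (ι : Type)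
      (w₀ w₁ : Fin (P.TS.vkLen k) ⊕ Fin (P.TS.sigLen k) → ι ⊕ Bool),
      HasCircuit (B k) fun x : Bits ι => (D k).circuit.eval (Sum.elim r (P.encViews
        (P.roundView M₀ K₀ ρ₀ (fun i => Sum.elim x id (w₀ (Sum.inl i)))
            (fun i => Sum.elim x id (w₀ (Sum.inr i))),
          P.roundView M₁ K₁ ρ₁ (fun i => Sum.elim x id (w₁ (Sum.inl i)))
            (fun i => Sum.elim x id (w₁ (Sum.inr i)))))) := by
  obtain ⟨B, hB, hB'⟩ := hP.roundView
  refine ⟨fun k => 3 + (B k + B k + ((D k).coins + (D k).circuit.size)),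
    (polyBounded_const 3).add ((hB.add hB).add hD), fun k M₀ M₁ K₀ ρ₀ K₁ ρ₁ r ι w₀ w₁ => ?_⟩
  -- The three extra gates are the constant `r` and the two selections. Since `w₀` and `w₁` may
  -- select constants, the same bound serves a round whose key and signature are advice.
  have c := HasCircuit.comp (g := (D k).circuit.eval) ⟨_, le_rfl, fun _ => rfl⟩
    ((HasCircuit.const r).sumElim (((hB' k M₀ K₀ ρ₀).comp (HasCircuit.select w₀)).sumElim
      ((hB' k M₁ K₁ ρ₁).comp (HasCircuit.select w₁))))
  exact c.mono (by dsimp only; omega)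

end Instance

/-! ### Reduction to the signer-indistinguishability game -/

namespace ThresholdScheme

variable (TS : ThresholdScheme)

theorem toSet_decide {n : ℕ} (C : Finset (Fin n)) : toSet (fun i => decide (i ∈ C)) = C := by
  ext i
  simp [toSet]

/-- What a circuit reads that is given the global verification key and two signatures. -/
abbrev twoSigInput {k : ℕ} (vk : TS.VK k) (s s' : TS.Sig k) : Bits (TS.AdvIn k 0) :=
  Sum.elim Fin.elim0 (Sum.elim vk fun p => ([s, s'].getD p.1 fun _ => false) p.2)

/-- A signature on `m` by the signers `C` and one on `m'` by the signers `U`, given to `g` together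
with the verification key. -/
def twoSigExperiment {k n : ℕ} (t : ℕ) (C U : Finset (Fin n)) (m m' : TS.Msg k)
    (g : Bits (TS.AdvIn k 0) → Bool) : PMF Bool :=
  (TS.keyGen k n t).bind fun keys => (TS.fullSign keys C m).bind fun s =>
    (TS.fullSign keys U m').bind fun s' => PMF.pure (g (TS.twoSigInput keys.1 s s'))

/-- The adversary that asks for a challenge and for one signature, both fixed in advance. -/
theorem exists_adversary {k n : ℕ} (t : ℕ) {C₀ C₁ U : Finset (Fin n)} (h₀ : C₀.card = t)
    (h₁ : C₁.card = t) (hU : U.card = t) (m m' : TS.Msg k) {B : ℕ}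
    {g : Bits (TS.AdvIn k 0) → Bool} (hg : HasCircuit B fun x (_ : Unit) => g x) :
    ∃ A : TS.SignerAdversary k n, A.size ≤ 3 + B ∧
      ∀ b, TS.signerGame t A b = TS.twoSigExperiment t (if b then C₁ else C₀) U m m' g := by
  obtain ⟨Cq, hq, hq'⟩ := HasCircuit.const (ι := TS.AdvIn k 0)
    (Sum.elim m' fun i : Fin n => decide (i ∈ U))
  obtain ⟨Cc, hc, hc'⟩ := HasCircuit.const (ι := TS.AdvIn k 0)
    (Sum.elim m (Sum.elim (fun i : Fin n => decide (i ∈ C₀)) fun i : Fin n => decide (i ∈ C₁)))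
  obtain ⟨Cg, hg, hg'⟩ := hg
  -- The single query comes after the challenge, so the challenge signature has index `0` and the
  -- oracle's answer index `1`. The `3` in the bound counts this query and one gate each for the
  -- constant circuits `Cq` and `Cc`.
  refine ⟨⟨0, 0, 1, fun _ => Cq, Cc, Cg⟩, ?_, fun b => ?_⟩
  · simp only [SignerAdversary.size, Finset.sum_const, Finset.card_range,
      smul_eq_mul, zero_add, one_mul]
    omega
  · have hr (r : Bits (Fin 0)) : r = Fin.elim0 := Subsingleton.elim _ _
    simp only [signerGame, runQueries, oracle, bind, pure, PMF.pure_bind, PMF.bind_bind,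
      List.nil_append, List.singleton_append, hq', hc', hg', Sum.elim_inl, Sum.elim_inr,
      toSet_decide, h₀, h₁, hU, and_self, if_true, SignerAdversary.input, hr, PMF.bind_const,
      twoSigExperiment]

variable {TS}

/-- For signatures on messages fixed in advance, signer indistinguishability holds uniformly in
the non-uniform advice `z`. -/
theorem SignerIndistinguishable.uniform {n t : ℕ → ℕ} (hTS : TS.SignerIndistinguishable n t)
    {Z : ℕ → Type} [∀ k, Finite (Z k)] [∀ k, Nonempty (Z k)]
    (C₀ C₁ U : ∀ k, Finset (Fin (n k))) (h₀ : ∀ k, (C₀ k).card = t k)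
    (h₁ : ∀ k, (C₁ k).card = t k) (hU : ∀ k, (U k).card = t k) (m m' : ∀ k, Z k → TS.Msg k)
    {B : ℕ → ℕ} (hB : PolyBounded B) (g : ∀ k, Z k → Bits (TS.AdvIn k 0) → Bool)
    (hg : ∀ k z, HasCircuit (B k) fun x (_ : Unit) => g k z x) :
    ∃ ε, Negligible ε ∧ ∀ k z,
      |(TS.twoSigExperiment (t k) (C₀ k) (U k) (m k z) (m' k z) (g k z) true).toReal -
        (TS.twoSigExperiment (t k) (C₁ k) (U k) (m k z) (m' k z) (g k z) true).toReal| ≤ ε k := by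
  -- The worst advice for each `k`; the advantage of the adversary with this advice built in serves
  -- as `ε`.
  choose z hz using fun k => Finite.exists_max fun z : Z k =>
    |(TS.twoSigExperiment (t k) (C₀ k) (U k) (m k z) (m' k z) (g k z) true).toReal -
      (TS.twoSigExperiment (t k) (C₁ k) (U k) (m k z) (m' k z) (g k z) true).toReal|
  choose A hA hA' using fun k =>
    TS.exists_adversary (t k) (h₀ k) (h₁ k) (hU k) (m k (z k)) (m' k (z k)) (hg k (z k))
  refine ⟨_, ?_, hz⟩
  have := hTS A (((polyBounded_const 3).add hB).mono hA)
  simpa only [hA', if_true, Bool.false_eq_true, if_false] using this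

end ThresholdScheme

/-! ### Separating keys and signatures from the other random choices -/

/-- Independent samples commute. What matters is that `g₁` takes only `m₀`: the second training may
depend on the first model, but not on keys or signatures. -/
theorem bind_reorder {α M₀ M₁ σ₀ σ₁ κ₀ κ₁ υ₀ υ₁ β : Type} (p : PMF α) (g₀ : PMF M₀)
    (g₁ : M₀ → PMF M₁) (s₀ : α → M₀ → PMF σ₀) (s₁ : α → M₁ → PMF σ₁) (k₀ : PMF κ₀) (u₀ : PMF υ₀)
    (k₁ : PMF κ₁) (u₁ : PMF υ₁) (f : α → M₀ → σ₀ → κ₀ → υ₀ → M₁ → σ₁ → κ₁ → υ₁ → PMF β) :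
    (p.bind fun a => g₀.bind fun m₀ => (s₀ a m₀).bind fun x₀ => k₀.bind fun y₀ => u₀.bind fun z₀ =>
      (g₁ m₀).bind fun m₁ => (s₁ a m₁).bind fun x₁ => k₁.bind fun y₁ => u₁.bind fun z₁ =>
        f a m₀ x₀ y₀ z₀ m₁ x₁ y₁ z₁) =
    g₀.bind fun m₀ => (g₁ m₀).bind fun m₁ => k₀.bind fun y₀ => u₀.bind fun z₀ =>
      k₁.bind fun y₁ => u₁.bind fun z₁ => p.bind fun a => (s₀ a m₀).bind fun x₀ =>
        (s₁ a m₁).bind fun x₁ => f a m₀ x₀ y₀ z₀ m₁ x₁ y₁ z₁ := by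
  -- Naming the two distributions in every exchange keeps the rewriting from undoing itself.
  simp_rw [PMF.bind_comm (s₁ _ _) k₁, PMF.bind_comm (s₁ _ _) u₁, PMF.bind_comm (s₀ _ _) k₀,
    PMF.bind_comm (s₀ _ _) u₀, PMF.bind_comm (s₀ _ _) (g₁ _), PMF.bind_comm (s₀ _ _) k₁,
    PMF.bind_comm (s₀ _ _) u₁, PMF.bind_comm u₀ (g₁ _), PMF.bind_comm k₀ (g₁ _),
    PMF.bind_comm p g₀, PMF.bind_comm p (g₁ _), PMF.bind_comm p k₀, PMF.bind_comm p u₀,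
    PMF.bind_comm p k₁, PMF.bind_comm p u₁]

namespace Instance

variable (P : Instance)

/-- This is where the identity of the prover disappears: `i` does not occur on the right. The
continuation `f` stands for the rest of the experiment, which inherits only the model and the view.
-/
theorem generate_prove {k : ℕ} {β : Type} (keys : P.TS.Keys k (P.n k))
    (N : SimpleGraph (P.Client k)) (O T : Finset (P.Client k)) (pp : P.Params)
    (D : P.Client k → P.Data) (i : {i // i ∈ O}) (f : P.Model k → P.RoundView k → PMF β) :
    ((P.generate keys N O T pp D).bind fun g => (P.prove (g.client i) g.provider).bind fun v =>
      f g.provider.model v) =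
    (P.globalModel N O pp D).bind fun M =>
      (P.TS.fullSign keys T (P.encModel k M)).bind fun s =>
        (PMF.uniformOfFintype (ZMod (P.𝔾.q k))).bind fun K =>
          (PMF.uniformOfFintype (ZMod (P.𝔾.q k))ˣ).bind fun u =>
            f M (P.roundView M K u keys.1 s) := by
  simp only [generate, bind, pure, PMF.bind_bind, PMF.pure_bind, prove_eq]

/-- The keys of the two rounds. -/
def keyPair (k : ℕ) : KeySchedule → PMF (P.TS.Keys k (P.n k) × P.TS.Keys k (P.n k))
  | .perRound => (P.TS.keyGen k (P.n k) (P.t k)).bind fun keys₀ =>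
      (P.TS.keyGen k (P.n k) (P.t k)).bind fun keys₁ => PMF.pure (keys₀, keys₁)
  | .shared => (P.TS.keyGen k (P.n k) (P.t k)).bind fun keys => PMF.pure (keys, keys)

/-- The signatures of the sets `T₀` and `T₁` on the models of the two rounds, given to `f` together
with the verification keys. -/
def signRounds {k : ℕ} {β : Type} (sched : KeySchedule) (T₀ T₁ : Finset (P.Client k))
    (M₀ M₁ : P.Model k) (f : P.TS.VK k → P.TS.Sig k → P.TS.VK k → P.TS.Sig k → β) : PMF β :=
  (P.keyPair k sched).bind fun keys =>
    (P.TS.fullSign keys.1 T₀ (P.encModel k M₀)).bind fun s₀ =>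
      (P.TS.fullSign keys.2 T₁ (P.encModel k M₁)).bind fun s₁ =>
        PMF.pure (f keys.1.1 s₀ keys.2.1 s₁)

/-- Everything but the keys and the signatures can be sampled first. -/
theorem jointView_eq {k : ℕ} (sched : KeySchedule) (E : P.TwoRounds k)
    (T : Fin 2 → Finset (P.Client k)) (prover : ∀ l, {i // i ∈ E.online l}) :
    P.jointView sched E T prover =
      (P.globalModel (E.graph 0) (E.online 0) E.params₀ (E.data 0)).bind fun M₀ =>
      (P.globalModel (E.graph 1) (E.online 1) (E.params₁ M₀) (E.data 1)).bind fun M₁ =>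
      (PMF.uniformOfFintype (ZMod (P.𝔾.q k))).bind fun K₀ =>
      (PMF.uniformOfFintype (ZMod (P.𝔾.q k))ˣ).bind fun u₀ =>
      (PMF.uniformOfFintype (ZMod (P.𝔾.q k))).bind fun K₁ =>
      (PMF.uniformOfFintype (ZMod (P.𝔾.q k))ˣ).bind fun u₁ =>
        P.signRounds sched (T 0) (T 1) M₀ M₁ fun vk₀ s₀ vk₁ s₁ =>
          (P.roundView M₀ K₀ u₀ vk₀ s₀, P.roundView M₁ K₁ u₁ vk₁ s₁) := by
  have h : P.jointView sched E T prover = (P.keyPair k sched).bind fun keys =>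
      (P.globalModel (E.graph 0) (E.online 0) E.params₀ (E.data 0)).bind fun M₀ =>
      (P.TS.fullSign keys.1 (T 0) (P.encModel k M₀)).bind fun s₀ =>
      (PMF.uniformOfFintype (ZMod (P.𝔾.q k))).bind fun K₀ =>
      (PMF.uniformOfFintype (ZMod (P.𝔾.q k))ˣ).bind fun u₀ =>
      (P.globalModel (E.graph 1) (E.online 1) (E.params₁ M₀) (E.data 1)).bind fun M₁ =>
      (P.TS.fullSign keys.2 (T 1) (P.encModel k M₁)).bind fun s₁ =>
      (PMF.uniformOfFintype (ZMod (P.𝔾.q k))).bind fun K₁ =>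
      (PMF.uniformOfFintype (ZMod (P.𝔾.q k))ˣ).bind fun u₁ =>
        PMF.pure (P.roundView M₀ K₀ u₀ keys.1.1 s₀, P.roundView M₁ K₁ u₁ keys.2.1 s₁) := by
    have h₀ (keys₀ keys₁ : P.TS.Keys k (P.n k)) :=
      P.generate_prove keys₀ (E.graph 0) (E.online 0) (T 0) E.params₀ (E.data 0) (prover 0)
        fun M₀ v₀ => (P.generate keys₁ (E.graph 1) (E.online 1) (T 1) (E.params₁ M₀)
          (E.data 1)).bind fun g₁ => (P.prove (g₁.client (prover 1)) g₁.provider).bind fun v₁ =>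
            PMF.pure (v₀, v₁)
    have h₁ (keys : P.TS.Keys k (P.n k)) (M₀ : P.Model k) (v₀ : P.RoundView k) :=
      P.generate_prove keys (E.graph 1) (E.online 1) (T 1) (E.params₁ M₀) (E.data 1) (prover 1)
        fun _ v₁ => PMF.pure (v₀, v₁)
    simp only [h₁] at h₀
    unfold jointView
    cases sched <;>
      simp only [bind, pure, keyPair, PMF.bind_bind, PMF.pure_bind, h₁, h₀]
  rw [h]
  exact bind_reorder _ _ _ _ _ _ _ _ _ _

/-- The two rounds play symmetric roles once the models are fixed, so a statement about the first
round's signers transfers to the second. -/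
theorem signRounds_swap {k : ℕ} {β : Type} (sched : KeySchedule) (T₀ T₁ : Finset (P.Client k))
    (M₀ M₁ : P.Model k) (f : P.TS.VK k → P.TS.Sig k → P.TS.VK k → P.TS.Sig k → β) :
    P.signRounds sched T₀ T₁ M₀ M₁ f =
      P.signRounds sched T₁ T₀ M₁ M₀ fun vk₁ s₁ vk₀ s₀ => f vk₀ s₀ vk₁ s₁ := by
  cases sched
  · simp only [signRounds, keyPair, PMF.bind_bind, PMF.pure_bind]
    rw [PMF.bind_comm]
    simp_rw [PMF.bind_comm (P.TS.fullSign _ T₀ (P.encModel k M₀))]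
  · simp only [signRounds, keyPair, PMF.bind_bind, PMF.pure_bind]
    exact congrArg (PMF.bind _) (funext fun _ => PMF.bind_comm _ _ _)

/-! ### Hybrid argument over the two rounds -/

variable {P}

/-- Replacing the signers of the first round is not noticed. -/
theorem exists_negligible_signers_first (hTS : P.TS.SignerIndistinguishable P.n P.t)
    (sched : KeySchedule) {Z : ℕ → Type} [∀ k, Finite (Z k)] [∀ k, Nonempty (Z k)]
    (S T U : ∀ k, Finset (P.Client k)) (hS : ∀ k, (S k).card = P.t k)
    (hT : ∀ k, (T k).card = P.t k) (hU : ∀ k, (U k).card = P.t k) (M₀ M₁ : ∀ k, Z k → P.Model k)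
    (F : ∀ k, Z k → P.TS.VK k → P.TS.Sig k → P.TS.VK k → P.TS.Sig k → Bool)
    {B : ℕ → ℕ} (hB : PolyBounded B)
    (hF : ∀ (k : ℕ) (z : Z k) (ι : Type)
      (w₀ w₁ : Fin (P.TS.vkLen k) ⊕ Fin (P.TS.sigLen k) → ι ⊕ Bool),
      HasCircuit (B k) fun (x : Bits ι) (_ : Unit) => F k z
        (fun i => Sum.elim x id (w₀ (Sum.inl i))) (fun i => Sum.elim x id (w₀ (Sum.inr i)))
        (fun i => Sum.elim x id (w₁ (Sum.inl i))) (fun i => Sum.elim x id (w₁ (Sum.inr i)))) :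
    ∃ ε, Negligible ε ∧ ∀ k z,
      |(P.signRounds sched (S k) (U k) (M₀ k z) (M₁ k z) (F k z) true).toReal -
        (P.signRounds sched (T k) (U k) (M₀ k z) (M₁ k z) (F k z) true).toReal| ≤ ε k := by
  let vk {k : ℕ} (x : Bits (P.TS.AdvIn k 0)) : P.TS.VK k := fun i => x (Sum.inr (Sum.inl i))
  let sg {k : ℕ} (j : ℕ) (x : Bits (P.TS.AdvIn k 0)) : P.TS.Sig k :=
    fun i => x (Sum.inr (Sum.inr (j, i)))
  cases sched
  -- With fresh keys, the key and signature of the other round are independent of the challenge and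
  -- join the advice. The oracle's answer is not read, and `PMF.bind_const` removes it.
  · obtain ⟨ε, hε, h⟩ := hTS.uniform (Z := fun k => Z k × P.TS.VK k × P.TS.Sig k) S T U hS hT hU
      (fun k z => P.encModel k (M₀ k z.1)) (fun k z => P.encModel k (M₁ k z.1)) hB
      (fun k z x => F k z.1 (vk x) (sg 0 x) z.2.1 z.2.2)
      (fun k z => hF k z.1 _
        (Sum.elim (fun i => Sum.inl (Sum.inr (Sum.inl i)))
          fun i => Sum.inl (Sum.inr (Sum.inr (0, i))))
        (Sum.elim (fun i => Sum.inr (z.2.1 i)) fun i => Sum.inr (z.2.2 i)))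
    refine ⟨ε, hε, fun k z => ?_⟩
    have hC (C : Finset (P.Client k)) :
        P.signRounds .perRound C (U k) (M₀ k z) (M₁ k z) (F k z) =
          (P.TS.keyGen k (P.n k) (P.t k)).bind fun keys =>
          (P.TS.fullSign keys (U k) (P.encModel k (M₁ k z))).bind fun s =>
            P.TS.twoSigExperiment (P.t k) C (U k) (P.encModel k (M₀ k z)) (P.encModel k (M₁ k z))
              fun x => F k z (vk x) (sg 0 x) keys.1 s := by
      rw [signRounds_swap]
      simp only [signRounds, keyPair, PMF.bind_bind, PMF.pure_bind,
        ThresholdScheme.twoSigExperiment]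
      refine congrArg (PMF.bind _) (funext fun keys => ?_)
      rw [PMF.bind_comm]
      simp only [vk, sg, Sum.elim_inr, Sum.elim_inl, List.getD_cons_zero, PMF.bind_const]
    rw [hC, hC]
    exact abs_toReal_bind_sub_le _ _ _ _ fun keys => abs_toReal_bind_sub_le _ _ _ _ fun s =>
      h k (z, keys.1, s)
  -- With a shared key, the other round's signature is made under the challenge key; it is the
  -- oracle's answer, at index `1`.
  · obtain ⟨ε, hε, h⟩ := hTS.uniform S T U hS hT hU
      (fun k z => P.encModel k (M₀ k z)) (fun k z => P.encModel k (M₁ k z)) hB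
      (fun k z x => F k z (vk x) (sg 0 x) (vk x) (sg 1 x))
      (fun k z => hF k z _
        (Sum.elim (fun i => Sum.inl (Sum.inr (Sum.inl i)))
          fun i => Sum.inl (Sum.inr (Sum.inr (0, i))))
        (Sum.elim (fun i => Sum.inl (Sum.inr (Sum.inl i)))
          fun i => Sum.inl (Sum.inr (Sum.inr (1, i)))))
    refine ⟨ε, hε, fun k z => ?_⟩
    have hC (C : Finset (P.Client k)) :
        P.signRounds .shared C (U k) (M₀ k z) (M₁ k z) (F k z) =
          P.TS.twoSigExperiment (P.t k) C (U k) (P.encModel k (M₀ k z)) (P.encModel k (M₁ k z))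
            fun x => F k z (vk x) (sg 0 x) (vk x) (sg 1 x) := by
      simp only [signRounds, keyPair, PMF.bind_bind, PMF.pure_bind,
        ThresholdScheme.twoSigExperiment]
      rfl
    rw [hC, hC]
    exact h k z

/-- Replacing the signers of both rounds is not noticed. -/
theorem exists_negligible_signers (hTS : P.TS.SignerIndistinguishable P.n P.t)
    (sched : KeySchedule) {Z : ℕ → Type} [∀ k, Finite (Z k)] [∀ k, Nonempty (Z k)]
    (S T : ∀ k, Fin 2 → Finset (P.Client k)) (hS : ∀ k l, (S k l).card = P.t k)
    (hT : ∀ k l, (T k l).card = P.t k) (M₀ M₁ : ∀ k, Z k → P.Model k)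
    (F : ∀ k, Z k → P.TS.VK k → P.TS.Sig k → P.TS.VK k → P.TS.Sig k → Bool)
    {B : ℕ → ℕ} (hB : PolyBounded B)
    (hF : ∀ (k : ℕ) (z : Z k) (ι : Type)
      (w₀ w₁ : Fin (P.TS.vkLen k) ⊕ Fin (P.TS.sigLen k) → ι ⊕ Bool),
      HasCircuit (B k) fun (x : Bits ι) (_ : Unit) => F k z
        (fun i => Sum.elim x id (w₀ (Sum.inl i))) (fun i => Sum.elim x id (w₀ (Sum.inr i)))
        (fun i => Sum.elim x id (w₁ (Sum.inl i))) (fun i => Sum.elim x id (w₁ (Sum.inr i)))) :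
    ∃ ε, Negligible ε ∧ ∀ k z,
      |(P.signRounds sched (S k 0) (S k 1) (M₀ k z) (M₁ k z) (F k z) true).toReal -
        (P.signRounds sched (T k 0) (T k 1) (M₀ k z) (M₁ k z) (F k z) true).toReal| ≤ ε k := by
  -- The intermediate hybrid has signers `T k 0` in the first round and `S k 1` in the second.
  obtain ⟨ε, hε, h⟩ := exists_negligible_signers_first hTS sched (fun k => S k 0)
    (fun k => T k 0) (fun k => S k 1) (fun k => hS k 0) (fun k => hT k 0) (fun k => hS k 1)
    M₀ M₁ F hB hF
  obtain ⟨δ, hδ, h'⟩ := exists_negligible_signers_first hTS sched (fun k => S k 1)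
    (fun k => T k 1) (fun k => T k 0) (fun k => hS k 1) (fun k => hT k 1) (fun k => hT k 0)
    M₁ M₀ (fun k z vk₁ s₁ vk₀ s₀ => F k z vk₀ s₀ vk₁ s₁) hB fun k z ι w₁ w₀ => hF k z ι w₀ w₁
  refine ⟨fun k => ε k + δ k, hε.add hδ, fun k z => ?_⟩
  have h'' := h' k z
  rw [P.signRounds_swap sched (S k 1), P.signRounds_swap sched (T k 1)] at h''
  exact (abs_sub_le _ _ _).trans (add_le_add (h k z) h'')

end Instance

end FedPoP

end

theorem mainTheorem4 (P : FedPoP.Instance) (hP : P.Efficient)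
    (hTS : P.TS.SignerIndistinguishable P.n P.t)
    (sched : FedPoP.Instance.KeySchedule)
    (E : ∀ k, P.TwoRounds k)
    (a : ∀ k, P.Client k) (ha : ∀ k l, a k ∈ (E k).online l)
    (b : ∀ k, Fin 2 → P.Client k) (hb : ∀ k l, b k l ∈ (E k).online l)
    (hne : ∀ k, b k 0 ≠ b k 1)
    (S T : ∀ k, Fin 2 → Finset (P.Client k))
    (hS : ∀ k l, S k l ⊆ (E k).online l ∧ (S k l).card = P.t k)
    (hT : ∀ k l, T k l ⊆ (E k).online l ∧ (T k l).card = P.t k) :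
    FedPoP.CompIndist
      (fun k => (P.jointView sched (E k) (S k) (fun l => ⟨a k, ha k l⟩)).map P.encViews)
      (fun k => (P.jointView sched (E k) (T k) (fun l => ⟨b k l, hb k l⟩)).map P.encViews) := by
  intro D hD
  obtain ⟨B, hB, hC⟩ := hP.distinguisher D hD
  let R (k : ℕ) : Type := P.Model k × ZMod (P.𝔾.q k) × (ZMod (P.𝔾.q k))ˣ
  let F (k : ℕ) (z : FedPoP.Bits (Fin (D k).coins) × R k × R k) (vk₀ : P.TS.VK k) (s₀ : P.TS.Sig k)
      (vk₁ : P.TS.VK k) (s₁ : P.TS.Sig k) : Bool :=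
    (D k).circuit.eval (Sum.elim z.1 (P.encViews
      (P.roundView z.2.1.1 z.2.1.2.1 z.2.1.2.2 vk₀ s₀,
        P.roundView z.2.2.1 z.2.2.2.1 z.2.2.2.2 vk₁ s₁))) ()
  obtain ⟨ε, hε, h⟩ := FedPoP.Instance.exists_negligible_signers hTS sched S T
    (fun k l => (hS k l).2) (fun k l => (hT k l).2) (fun k z => z.2.1.1) (fun k z => z.2.2.1) F hB
    fun k z ι w₀ w₁ => hC k _ _ _ _ _ _ _ ι w₀ w₁
  refine hε.mono fun k => ?_
  -- The right side is free of `prover`, so after rewriting the two experiments differ only in the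
  -- signing sets.
  have hD (T : Fin 2 → Finset (P.Client k)) (prover : ∀ l, {i // i ∈ (E k).online l}) :
      (D k).output ((P.jointView sched (E k) T prover).map P.encViews) =
      (PMF.uniformOfFintype (FedPoP.Bits (Fin (D k).coins))).bind fun r =>
      (P.globalModel ((E k).graph 0) ((E k).online 0) (E k).params₀ ((E k).data 0)).bind fun M₀ =>
      (P.globalModel ((E k).graph 1) ((E k).online 1) ((E k).params₁ M₀)
        ((E k).data 1)).bind fun M₁ =>
      (PMF.uniformOfFintype (ZMod (P.𝔾.q k))).bind fun K₀ =>
      (PMF.uniformOfFintype (ZMod (P.𝔾.q k))ˣ).bind fun u₀ =>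
      (PMF.uniformOfFintype (ZMod (P.𝔾.q k))).bind fun K₁ =>
      (PMF.uniformOfFintype (ZMod (P.𝔾.q k))ˣ).bind fun u₁ =>
        P.signRounds sched (T 0) (T 1) M₀ M₁ (F k (r, (M₀, K₀, u₀), (M₁, K₁, u₁))) := by
    simp only [FedPoP.Distinguisher.output, FedPoP.Instance.jointView_eq,
      FedPoP.Instance.signRounds, PMF.map, bind, pure, PMF.bind_bind, PMF.pure_bind,
      Function.comp_apply, F]
  rw [hD, hD]
  -- The bound `ε k` holds for every value of the advice, hence survives averaging over each of its
  -- components.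
  exact FedPoP.abs_toReal_bind_sub_le _ _ _ _ fun r =>
    FedPoP.abs_toReal_bind_sub_le _ _ _ _ fun M₀ =>
    FedPoP.abs_toReal_bind_sub_le _ _ _ _ fun M₁ => FedPoP.abs_toReal_bind_sub_le _ _ _ _ fun K₀ =>
    FedPoP.abs_toReal_bind_sub_le _ _ _ _ fun u₀ => FedPoP.abs_toReal_bind_sub_le _ _ _ _ fun K₁ =>
    FedPoP.abs_toReal_bind_sub_le _ _ _ _ fun u₁ => h k (r, (M₀, K₀, u₀), (M₁, K₁, u₁))
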